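/- Let $q\in(0,1)$ be a real number and let $\phi_k(x;1):=\prod_{j=0}^{k-1}(1-2xq^j+q^{2j})$ for $k\ge 0$ (so $\phi_0(x;1)=1$). Let $(a_k)_{k\ge 0}$ be a sequence of complex numbers such that the Askey-Wilson series $$f(x)=\sum_{k=0}^\infty a_k\,\phi_k(x;1)$$ converges for every $x\in\mathbb{C}$ and its sum $f$ is a non-constant entire function. Let $$\sigma_{\log}:=\limsup_{r\to\infty}\frac{\ln^+\ln^+ M(r;f)}{\ln\ln r},\qquad M(r;f):=\max_{|x|=r}|f(x)|,\qquad \ln^+t:=\max\{\ln t,0\}\quad(\ln^+0:=0),$$ be the logarithmic order of $f$, and suppose that $\sigma_{\log}<2$. Then $$\frac{1}{\sigma_{\log}-1}=\liminf_{n\to\infty}\frac{\ln\ln\frac{1}{|a_n|}}{\ln n}-1$$ as an equality in $[-\infty,+\infty]$, where $\frac{1}{0}:=+\infty$ on the left, $\ln\ln\frac{1}{|a_n|}:=+\infty$ if $a_n=0$, and $\ln\ln\frac{1}{|a_n|}:=-\infty$ if $|a_n|\ge 1$. -/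

import Mathlib

open Filter Topology

/-- The Askey-Wilson basis polynomial of degree `k` with parameter `a`,
`(a z, a / z; q)_k = ∏_{j < k} (1 - 2 a x q^j + a^2 q^(2j))` where `x = (z + z⁻¹) / 2`.
It is the basis at the base point `x₀ = (a + a⁻¹) / 2`; the base point `x₀ = 1` means `a = 1`. -/
noncomputable def awBasis (q : ℝ) (a : ℂ) (k : ℕ) (x : ℂ) : ℂ :=
  ∏ j ∈ Finset.range k, (1 - 2 * a * x * (q : ℂ) ^ j + a ^ 2 * (q : ℂ) ^ (2 * j))

/-- `M(r; f)`, the maximum of `|f(x)|` over the circle `|x| = r`. -/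
noncomputable def maxModulus (f : ℂ → ℂ) (r : ℝ) : ℝ :=
  sSup ((fun x => ‖f x‖) '' Metric.sphere (0 : ℂ) r)

/-- The logarithmic order `limsup_{r → ∞} ln⁺ ln⁺ M(r; f) / ln ln r`, an extended real number. -/
noncomputable def logOrder (f : ℂ → ℂ) : EReal :=
  limsup (fun r : ℝ =>
    ((Real.posLog (Real.posLog (maxModulus f r)) / Real.log (Real.log r) : ℝ) : EReal)) atTop

/-- The reciprocal of an extended real number, with `1 / 0 = +∞` (and `1 / (±∞) = 0`). -/
noncomputable def extRecip (x : EReal) : EReal :=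
  if x = 0 then ⊤ else x⁻¹

/-- `ln ln (1 / |w|)` as an extended real number, equal to `+∞` for `w = 0`. For `|w| ≥ 1`, where
the outer logarithm has a non-positive argument, the value is `-∞`. -/
noncomputable def logLogInv (w : ℂ) : EReal :=
  ENNReal.log (ENNReal.log (‖w‖ₑ)⁻¹).toENNReal

/-!
A series in the Askey-Wilson basis with parameter `1` terminates at each zero
`x_k = (q ^ k + q ^ (-k)) / 2` of the basis polynomials, so it is the Newton interpolation series
of `f` at these nodes (`awQuotient_node_eq_coeff`). Both inequalities between the order `σ` of `f`
and the lower limit `L` of `ln ln (1 / |a_n|) / ln n` are then elementary.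

If `|f| ≤ exp ((ln r) ^ s)` for large `r`, then repeated division by the factors
`1 - 2 x q ^ k + q ^ (2 k)` and the maximum principle give the Cauchy estimate
`|a_n| ≤ M(R; f) (2 / (R q ^ n)) ^ n` for `R ≥ 2 q ^ (-n)` (`norm_coeff_le`). For `1 < s < 2` the
choice `ln R = n ^ (1 / (s - 1)) / 2` yields `ln (1 / |a_n|) ≥ c n ^ (1 + 1 / (s - 1))`
(`eventually_norm_coeff_le`), hence `L ≥ 1 + 1 / (σ - 1)`. For `s < 1`, letting `R` tend to
infinity shows that `f` is constant (`one_le_logOrder`), hence `σ ≥ 1`.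

Conversely, if `|a_n| ≤ exp (-n ^ y)` for large `n` and `y > 1`, the bound `(4 r) ^ k` for the
`k`-th basis polynomial on `|x| = r` and the maximum `O((ln r) ^ (y / (y - 1)))` of
`k ln (4 r) - k ^ y` over `k` give `σ ≤ y / (y - 1)` (`logOrder_le_of_norm_coeff_le`), that is,
`y - 1 ≤ 1 / (σ - 1)`.
-/

/-! ### Growth of the maximum modulus and the logarithmic order -/

theorem bddAbove_norm_sphere {f : ℂ → ℂ} (hf : Continuous f) (r : ℝ) :
    BddAbove ((fun x => ‖f x‖) '' Metric.sphere (0 : ℂ) r) :=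
  ((isCompact_sphere (0 : ℂ) r).image hf.norm).bddAbove

theorem maxModulus_nonneg (f : ℂ → ℂ) (r : ℝ) : 0 ≤ maxModulus f r := by
  apply Real.sSup_nonneg
  rintro _ ⟨x, -, rfl⟩
  exact norm_nonneg _

theorem norm_le_maxModulus_of_norm_le {f : ℂ → ℂ} (hf : Differentiable ℂ f) {R : ℝ} (hR : 0 < R)
    {z : ℂ} (hz : ‖z‖ ≤ R) : ‖f z‖ ≤ maxModulus f R := by
  refine Complex.norm_le_of_forall_mem_frontier_norm_le (U := Metric.ball 0 R)
    Metric.isBounded_ball hf.diffContOnCl (fun w hw => ?_) ?_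
  · rw [frontier_ball _ hR.ne'] at hw
    exact le_csSup (bddAbove_norm_sphere hf.continuous R) ⟨w, hw, rfl⟩
  · rw [closure_ball _ hR.ne']
    simpa using hz

theorem maxModulus_le {f : ℂ → ℂ} {r B : ℝ} (hB : 0 ≤ B) (h : ∀ z, ‖z‖ = r → ‖f z‖ ≤ B) :
    maxModulus f r ≤ B := by
  apply Real.sSup_le _ hB
  rintro _ ⟨x, hx, rfl⟩
  exact h x (by simpa using hx)

theorem le_exp_posLog (x : ℝ) : x ≤ Real.exp (Real.posLog x) := by
  rcases le_or_gt x 0 with hx | hx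
  · exact hx.trans (Real.exp_pos _).le
  · calc x = Real.exp (Real.log x) := (Real.exp_log hx).symm
      _ ≤ _ := Real.exp_le_exp.2 (by rw [Real.posLog_apply]; exact le_max_right _ _)

theorem eventually_maxModulus_le_of_logOrder_lt {f : ℂ → ℂ} {s : ℝ} (h : logOrder f < s) :
    ∀ᶠ r : ℝ in atTop, maxModulus f r ≤ Real.exp (Real.log r ^ s) := by
  have hll := (Real.tendsto_log_atTop.comp Real.tendsto_log_atTop).eventually_gt_atTop 0
  filter_upwards [eventually_lt_of_limsup_lt h, hll, Real.tendsto_log_atTop.eventually_gt_atTop 0]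
    with r hr h0 hl
  simp only [Function.comp_apply] at h0
  rw [EReal.coe_lt_coe_iff, div_lt_iff₀ h0] at hr
  refine (le_exp_posLog _).trans (Real.exp_le_exp.2 ((le_exp_posLog _).trans ?_))
  rw [Real.rpow_def_of_pos hl]
  exact Real.exp_le_exp.2 (by linarith)

theorem logOrder_le_of_eventually_maxModulus_le {f : ℂ → ℂ} {s : ℝ} (hs : 0 ≤ s)
    (h : ∀ᶠ r : ℝ in atTop, maxModulus f r ≤ Real.exp (Real.log r ^ s)) : logOrder f ≤ s := by
  have hll := (Real.tendsto_log_atTop.comp Real.tendsto_log_atTop).eventually_gt_atTop 0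
  refine limsup_le_of_le (by isBoundedDefault) ?_
  filter_upwards [h, hll, Real.tendsto_log_atTop.eventually_ge_atTop 1] with r hr h0 hl
  simp only [Function.comp_apply] at h0
  rw [EReal.coe_le_coe_iff, div_le_iff₀ h0]
  have h1 : 1 ≤ Real.log r ^ s := Real.one_le_rpow hl hs
  have h2 : Real.posLog (maxModulus f r) ≤ Real.log r ^ s := by
    refine (Real.posLog_le_posLog (maxModulus_nonneg f r) hr).trans_eq ?_
    rw [Real.posLog_apply, Real.log_exp, max_eq_right (by linarith)]
  refine (Real.posLog_le_posLog Real.posLog_nonneg h2).trans_eq ?_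
  rw [Real.posLog_eq_log (by rwa [abs_of_pos (by linarith)]), Real.log_rpow (by linarith)]

theorem eventually_const_mul_rpow_le_rpow (c : ℝ) {a b : ℝ} (hab : a < b) :
    ∀ᶠ x : ℝ in atTop, c * x ^ a ≤ x ^ b := by
  filter_upwards [(tendsto_rpow_atTop (sub_pos.2 hab)).eventually_ge_atTop c,
    eventually_gt_atTop 0] with x hx h0
  calc c * x ^ a ≤ x ^ (b - a) * x ^ a := by gcongr
    _ = x ^ b := by rw [← Real.rpow_add h0]; ring_nf

/-! ### The iterated logarithm of the coefficients -/

theorem coe_le_logLogInv_iff {w : ℂ} {y : ℝ} :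
    (y : EReal) ≤ logLogInv w ↔ ‖w‖ ≤ Real.exp (-Real.exp y) := by
  have hlog (t : ℝ) : (t : EReal) = ENNReal.log (ENNReal.ofReal (Real.exp t)) := by
    rw [ENNReal.log_ofReal_of_pos (Real.exp_pos t), Real.log_exp]
  have key (x : EReal) : ENNReal.ofReal (Real.exp y) ≤ x.toENNReal ↔ (Real.exp y : EReal) ≤ x := by
    have h0 : (0 : EReal) < (Real.exp y : ℝ) := by exact_mod_cast Real.exp_pos y
    constructor
    · intro h
      by_contra! hx
      rcases le_or_gt x 0 with h1 | h1
      · rw [EReal.toENNReal_of_nonpos h1] at h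
        simp only [nonpos_iff_eq_zero, ENNReal.ofReal_eq_zero] at h
        exact absurd (Real.exp_pos y) (not_lt.2 h)
      · have := EReal.toENNReal_lt_toENNReal h1.le hx
        rw [EReal.real_coe_toENNReal] at this
        exact absurd h (not_le.2 this)
    · intro h
      simpa using EReal.toENNReal_le_toENNReal h
  rw [logLogInv, hlog y, ENNReal.log_le_log_iff, key, hlog (Real.exp y), ENNReal.log_le_log_iff,
    ENNReal.le_inv_iff_le_inv, ← ENNReal.ofReal_inv_of_pos (Real.exp_pos _), ← Real.exp_neg,
    ← ofReal_norm, ENNReal.ofReal_le_ofReal_iff (Real.exp_pos _).le]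

theorem coe_le_logLogInv_div_log_iff {w : ℂ} {n : ℕ} (hn : 2 ≤ n) {y : ℝ} :
    (y : EReal) ≤ logLogInv w / ((Real.log (n : ℝ) : ℝ) : EReal) ↔
      ‖w‖ ≤ Real.exp (-(n : ℝ) ^ y) := by
  have hn' : (1 : ℝ) < n := by exact_mod_cast hn
  have h0 : (0 : EReal) < (Real.log (n : ℝ) : ℝ) := by exact_mod_cast Real.log_pos hn'
  rw [EReal.le_div_iff_mul_le h0 (EReal.coe_ne_top _), ← EReal.coe_mul, coe_le_logLogInv_iff,
    Real.rpow_def_of_pos (by linarith), mul_comm]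

/-! ### Coefficients of a series in the Askey-Wilson basis -/

/-- The node `(q ^ k + q ^ (-k)) / 2`, the zero of the factor of index `k` of the basis
polynomials with parameter `1`. -/
noncomputable def awNode (q : ℝ) (k : ℕ) : ℂ := ((q : ℂ) ^ k + ((q : ℂ) ^ k)⁻¹) / 2

/-- The Newton quotients of `f` at the nodes `awNode q 0, awNode q 1, …`: starting from `f`, the
value at the next node is subtracted and the difference is divided by the corresponding factor
`1 - 2 z q ^ k + q ^ (2 k) = -2 q ^ k (z - awNode q k)` of the basis polynomials. Dividing by
means of `dslope` keeps the quotients entire. -/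
noncomputable def awQuotient (q : ℝ) (f : ℂ → ℂ) : ℕ → ℂ → ℂ
  | 0 => f
  | k + 1 => fun z => dslope (awQuotient q f k) (awNode q k) z / (-2 * (q : ℂ) ^ k)

section Newton

variable {q : ℝ} {f : ℂ → ℂ} {a : ℕ → ℂ}

theorem awFactor_eq (hq0 : 0 < q) (k : ℕ) (z : ℂ) :
    1 - 2 * 1 * z * (q : ℂ) ^ k + 1 ^ 2 * (q : ℂ) ^ (2 * k) =
      -2 * (q : ℂ) ^ k * (z - awNode q k) := by
  have hq : (q : ℂ) ^ k ≠ 0 := pow_ne_zero _ (by exact_mod_cast hq0.ne')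
  rw [awNode]
  field_simp
  ring

theorem awFactor_mul_awQuotient_succ (hq0 : 0 < q) (f : ℂ → ℂ) (k : ℕ) (z : ℂ) :
    (1 - 2 * 1 * z * (q : ℂ) ^ k + 1 ^ 2 * (q : ℂ) ^ (2 * k)) * awQuotient q f (k + 1) z =
      awQuotient q f k z - awQuotient q f k (awNode q k) := by
  have hq : (q : ℂ) ^ k ≠ 0 := pow_ne_zero _ (by exact_mod_cast hq0.ne')
  have h := sub_smul_dslope (awQuotient q f k) (awNode q k) z
  rw [smul_eq_mul] at h
  rw [awFactor_eq hq0, awQuotient, ← h]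
  field_simp

theorem differentiable_awQuotient (hf : Differentiable ℂ f) (k : ℕ) :
    Differentiable ℂ (awQuotient q f k) := by
  induction k with
  | zero => exact hf
  | succ k ih =>
    have : Differentiable ℂ (dslope (awQuotient q f k) (awNode q k)) := by
      rw [← differentiableOn_univ, Complex.differentiableOn_dslope univ_mem]
      exact ih.differentiableOn
    exact this.div_const _

theorem awBasis_node_eq_zero (hq0 : 0 < q) {k n : ℕ} (h : k < n) :
    awBasis q 1 n (awNode q k) = 0 := by
  refine Finset.prod_eq_zero (Finset.mem_range.2 h) ?_
  rw [awFactor_eq hq0, sub_self, mul_zero]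

theorem awBasis_node_ne_zero (hq0 : 0 < q) (hq1 : q < 1) (k : ℕ) :
    awBasis q 1 k (awNode q k) ≠ 0 := by
  refine Finset.prod_ne_zero_iff.2 fun j hj => ?_
  have hjk : j < k := Finset.mem_range.1 hj
  have hq : (q : ℂ) ^ k ≠ 0 := pow_ne_zero _ (by exact_mod_cast hq0.ne')
  have h : 1 - 2 * 1 * awNode q k * (q : ℂ) ^ j + 1 ^ 2 * (q : ℂ) ^ (2 * j) =
      (1 - (q : ℂ) ^ (j + k)) * (1 - (q : ℂ) ^ j / (q : ℂ) ^ k) := by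
    rw [awNode]
    field_simp
    ring
  rw [h]
  refine mul_ne_zero (sub_ne_zero.2 ?_) (sub_ne_zero.2 ?_)
  · exact_mod_cast (pow_lt_one₀ hq0.le hq1 (by omega)).ne'
  · rw [ne_comm, Ne, div_eq_one_iff_eq hq]
    exact_mod_cast (pow_lt_pow_right_of_lt_one₀ hq0 hq1 hjk).ne'

theorem apply_awNode_eq_sum (hq0 : 0 < q)
    (hfa : ∀ x : ℂ, Tendsto
      (fun n : ℕ => ∑ k ∈ Finset.range n, a k * awBasis q 1 k x) atTop (𝓝 (f x))) (k : ℕ) :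
    f (awNode q k) = ∑ j ∈ Finset.range (k + 1), a j * awBasis q 1 j (awNode q k) := by
  refine tendsto_nhds_unique (hfa _) (tendsto_atTop_of_eventually_const (i₀ := k + 1) ?_)
  intro n hn
  refine (Finset.sum_subset (Finset.range_subset_range.2 hn) fun j _ hj => ?_).symm
  rw [awBasis_node_eq_zero hq0 (by simpa using hj), mul_zero]

/-- The series is determined by the values of `f` at the nodes, where it terminates; hence its
coefficients are those of Newton interpolation. -/
theorem awQuotient_node_eq_coeff (hq0 : 0 < q) (hq1 : q < 1)
    (hfa : ∀ x : ℂ, Tendsto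
      (fun n : ℕ => ∑ k ∈ Finset.range n, a k * awBasis q 1 k x) atTop (𝓝 (f x))) (k : ℕ) :
    awQuotient q f k (awNode q k) = a k := by
  -- If the Newton remainder formula holds at stage `k`, evaluate it at the `k`-th node.
  have step (k : ℕ) (h : ∀ z, f z = ∑ j ∈ Finset.range k, a j * awBasis q 1 j z +
      awBasis q 1 k z * awQuotient q f k z) : awQuotient q f k (awNode q k) = a k := by
    have h1 := apply_awNode_eq_sum hq0 hfa k
    rw [h, Finset.sum_range_succ, add_right_inj, mul_comm] at h1
    exact mul_right_cancel₀ (awBasis_node_ne_zero hq0 hq1 k) h1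
  refine step k ?_
  induction k with
  | zero => intro z; simp [awBasis, awQuotient]
  | succ k ih =>
    intro z
    have h2 := awFactor_mul_awQuotient_succ hq0 f k z
    rw [step k ih] at h2
    have h3 : awBasis q 1 (k + 1) z = awBasis q 1 k z *
        (1 - 2 * 1 * z * (q : ℂ) ^ k + 1 ^ 2 * (q : ℂ) ^ (2 * k)) := Finset.prod_range_succ _ _
    rw [Finset.sum_range_succ, h3, mul_assoc, h2, ih z]
    ring

theorem norm_awNode_le (hq0 : 0 < q) (hq1 : q < 1) {k n : ℕ} (hkn : k ≤ n) :
    ‖awNode q k‖ ≤ (q ^ n)⁻¹ := by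
  have h1 : q ^ n ≤ q ^ k := pow_le_pow_of_le_one hq0.le hq1.le hkn
  have h2 : (q ^ k)⁻¹ ≤ (q ^ n)⁻¹ := inv_anti₀ (pow_pos hq0 n) h1
  have h3 : q ^ k ≤ 1 := pow_le_one₀ hq0.le hq1.le
  have h4 : 1 ≤ (q ^ k)⁻¹ := (one_le_inv₀ (pow_pos hq0 k)).2 h3
  have h5 : awNode q k = (((q ^ k + (q ^ k)⁻¹) / 2 : ℝ) : ℂ) := by rw [awNode]; push_cast; rfl
  rw [h5, Complex.norm_real, Real.norm_of_nonneg (by positivity)]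
  linarith

theorem le_norm_awFactor (hq0 : 0 < q) (hq1 : q < 1) {k n : ℕ} (hkn : k ≤ n) {R : ℝ}
    (hR : 2 ≤ R * q ^ n) {z : ℂ} (hz : ‖z‖ = R) :
    R * q ^ n ≤ ‖1 - 2 * 1 * z * (q : ℂ) ^ k + 1 ^ 2 * (q : ℂ) ^ (2 * k)‖ := by
  have hR0 : 0 ≤ R := hz ▸ norm_nonneg z
  have h1 : R * q ^ n ≤ R * q ^ k :=
    mul_le_mul_of_nonneg_left (pow_le_pow_of_le_one hq0.le hq1.le hkn) hR0
  have h2 : ‖(1 : ℂ) + (q : ℂ) ^ (2 * k)‖ ≤ 2 := by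
    refine (norm_add_le _ _).trans ?_
    rw [norm_one, norm_pow, Complex.norm_real, Real.norm_of_nonneg hq0.le]
    linarith [pow_le_one₀ (n := 2 * k) hq0.le hq1.le]
  have h3 : ‖2 * z * (q : ℂ) ^ k‖ = 2 * (R * q ^ k) := by
    rw [norm_mul, norm_mul, norm_pow, Complex.norm_real, Real.norm_of_nonneg hq0.le, hz]
    norm_num
    ring
  have h4 := norm_sub_norm_le (2 * z * (q : ℂ) ^ k) (1 + (q : ℂ) ^ (2 * k))
  rw [← norm_neg (_ - _)] at h4
  have h5 : 1 - 2 * 1 * z * (q : ℂ) ^ k + 1 ^ 2 * (q : ℂ) ^ (2 * k) =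
      -(2 * z * (q : ℂ) ^ k - (1 + (q : ℂ) ^ (2 * k))) := by ring
  rw [h5]
  linarith

/-- A Cauchy estimate for the Newton quotients. On the circle `|z| = R` each division costs a
factor `2 / (R q ^ n)`; the maximum principle carries the bound into the disc, which contains the
nodes. -/
theorem norm_awQuotient_le (hq0 : 0 < q) (hq1 : q < 1) (hf : Differentiable ℂ f) {n : ℕ} {R : ℝ}
    (hR : 2 ≤ R * q ^ n) {k : ℕ} (hkn : k ≤ n) {z : ℂ} (hz : ‖z‖ ≤ R) :
    ‖awQuotient q f k z‖ ≤ maxModulus f R * (2 / (R * q ^ n)) ^ k := by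
  have hqn := pow_pos hq0 n
  have hR0 : 0 < R := by
    by_contra! h
    nlinarith
  induction k generalizing z with
  | zero => simpa [awQuotient] using norm_le_maxModulus_of_norm_le hf hR0 hz
  | succ k ih =>
    refine Complex.norm_le_of_forall_mem_frontier_norm_le (U := Metric.ball 0 R)
      Metric.isBounded_ball (differentiable_awQuotient hf (k + 1)).diffContOnCl (fun w hw => ?_) ?_
    · have hw' : ‖w‖ = R := by
        rw [frontier_ball _ hR0.ne'] at hw
        simpa using hw
      have hnode : ‖awNode q k‖ ≤ R := by
        refine (norm_awNode_le hq0 hq1 (show k ≤ n by omega)).trans ?_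
        rw [inv_le_iff_one_le_mul₀ hqn]
        linarith
      have h1 := ih (by omega) hw'.le
      have h2 := ih (by omega) hnode
      have h3 := le_norm_awFactor hq0 hq1 (show k ≤ n by omega) hR hw'
      have h4 := congrArg norm (awFactor_mul_awQuotient_succ hq0 f k w)
      rw [norm_mul] at h4
      have h5 : R * q ^ n * ‖awQuotient q f (k + 1) w‖ ≤
          2 * (maxModulus f R * (2 / (R * q ^ n)) ^ k) := by
        calc _ ≤ _ := mul_le_mul_of_nonneg_right h3 (norm_nonneg _)
          _ = _ := h4
          _ ≤ _ := norm_sub_le _ _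
          _ ≤ _ := by linarith
      rw [← le_div_iff₀' (by positivity)] at h5
      refine h5.trans_eq ?_
      rw [pow_succ]
      ring
    · rw [closure_ball _ hR0.ne']
      simpa using hz

theorem norm_coeff_le (hq0 : 0 < q) (hq1 : q < 1) (hf : Differentiable ℂ f)
    (hfa : ∀ x : ℂ, Tendsto
      (fun n : ℕ => ∑ k ∈ Finset.range n, a k * awBasis q 1 k x) atTop (𝓝 (f x)))
    {n : ℕ} {R : ℝ} (hR : 2 ≤ R * q ^ n) :
    ‖a n‖ ≤ maxModulus f R * (2 / (R * q ^ n)) ^ n := by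
  rw [← awQuotient_node_eq_coeff hq0 hq1 hfa n]
  refine norm_awQuotient_le hq0 hq1 hf hR le_rfl ((norm_awNode_le hq0 hq1 le_rfl).trans ?_)
  rw [inv_le_iff_one_le_mul₀ (pow_pos hq0 n)]
  linarith

/-! ### From the growth of the function to the decay of the coefficients -/

/-- A sum of logarithmic order less than `1` is constant: the Cauchy estimate, with the radius
tending to infinity, kills every coefficient of positive index. -/
theorem one_le_logOrder (hq0 : 0 < q) (hq1 : q < 1) (hf : Differentiable ℂ f)
    (hfa : ∀ x : ℂ, Tendsto
      (fun n : ℕ => ∑ k ∈ Finset.range n, a k * awBasis q 1 k x) atTop (𝓝 (f x)))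
    (hnc : ¬ ∃ c : ℂ, ∀ x : ℂ, f x = c) : 1 ≤ logOrder f := by
  by_contra! hlt
  obtain ⟨s, hs, hs1⟩ := EReal.lt_iff_exists_real_btwn.1 hlt
  have hs1 : s < 1 := by exact_mod_cast hs1
  have ha (n : ℕ) (hn : 1 ≤ n) : a n = 0 := by
    have hqn := pow_pos hq0 n
    rw [← norm_le_zero_iff]
    have hlim : Tendsto (fun r : ℝ => 2 / q ^ n * Real.exp (-(2⁻¹ * Real.log r))) atTop (𝓝 0) := by
      rw [← mul_zero (2 / q ^ n)]
      refine Tendsto.const_mul _ (Real.tendsto_exp_atBot.comp (tendsto_neg_atTop_atBot.comp ?_))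
      exact Real.tendsto_log_atTop.const_mul_atTop (by norm_num)
    refine ge_of_tendsto hlim ?_
    filter_upwards [eventually_maxModulus_le_of_logOrder_lt hs, eventually_gt_atTop 0,
      eventually_ge_atTop (2 / q ^ n),
      Real.tendsto_log_atTop.eventually (eventually_const_mul_rpow_le_rpow 2 hs1)] with r h1 h2 h3 h4
    rw [Real.rpow_one] at h4
    rw [div_le_iff₀ hqn] at h3
    have h5 : 2 / (r * q ^ n) ≤ 1 := (div_le_one (by linarith)).2 h3
    calc ‖a n‖ ≤ maxModulus f r * (2 / (r * q ^ n)) ^ n := norm_coeff_le hq0 hq1 hf hfa h3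
      _ ≤ Real.exp (2⁻¹ * Real.log r) * (2 / (r * q ^ n)) := by
          refine mul_le_mul (h1.trans (Real.exp_le_exp.2 (by linarith)))
            (pow_le_of_le_one (by positivity) h5 (by omega)) (by positivity) (Real.exp_pos _).le
      _ = 2 / q ^ n * Real.exp (-(2⁻¹ * Real.log r)) := by
          have h6 : r = Real.exp (2⁻¹ * Real.log r) * Real.exp (2⁻¹ * Real.log r) := by
            rw [← Real.exp_add, ← add_mul]
            norm_num [Real.exp_log h2]
          rw [Real.exp_neg]
          nth_rewrite 2 [h6]
          field_simp
  refine hnc ⟨a 0, fun x => tendsto_nhds_unique (hfa x)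
    (tendsto_atTop_of_eventually_const (i₀ := 1) fun n hn => ?_)⟩
  rw [Finset.sum_eq_single_of_mem 0 (Finset.mem_range.2 (by omega))]
  · simp [awBasis]
  · intro k _ hk
    rw [ha k (by omega), zero_mul]

/-- Here the hypothesis `s < 2` enters: it makes the exponent `1 / (s - 1)` exceed `1`, so that the
loss `(2 / q ^ n) ^ n` in the Cauchy estimate, of logarithm `O(n ^ 2)`, is negligible. -/
theorem eventually_norm_coeff_le (hq0 : 0 < q) (hq1 : q < 1) (hf : Differentiable ℂ f)
    (hfa : ∀ x : ℂ, Tendsto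
      (fun n : ℕ => ∑ k ∈ Finset.range n, a k * awBasis q 1 k x) atTop (𝓝 (f x)))
    {s y : ℝ} (hs1 : 1 < s) (hs2 : s < 2) (hs : logOrder f < s) (hy : (y - 1) * (s - 1) < 1) :
    ∀ᶠ n : ℕ in atTop, ‖a n‖ ≤ Real.exp (-(n : ℝ) ^ y) := by
  have hs0 : 0 < s - 1 := by linarith
  set p : ℝ := 1 / (s - 1) with hp
  have hp1 : 1 < p := by rw [hp, lt_div_iff₀ hs0]; linarith
  have hyp : y - 1 < p := by rw [hp, lt_div_iff₀ hs0]; exact hy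
  set d : ℝ := 1 - 2⁻¹ ^ (s - 1) with hd
  have hd0 : 0 < d := by
    have := Real.rpow_lt_one (x := 2⁻¹) (by norm_num) (by norm_num) hs0
    linarith
  -- The radius is `exp (n ^ p / 2)`; the factor `1 / 2` leaves the gain `d > 0` in the exponent.
  have ht : Tendsto (fun n : ℕ => 2⁻¹ * (n : ℝ) ^ p) atTop atTop :=
    ((tendsto_rpow_atTop (by linarith)).comp tendsto_natCast_atTop_atTop).const_mul_atTop
      (by norm_num)
  have hlim := tendsto_natCast_atTop_atTop (R := ℝ)
  set L : ℝ := -Real.log q with hL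
  have hL0 : 0 < L := by rw [hL, neg_pos]; exact Real.log_neg hq0 hq1
  have hln2 : 0 < Real.log 2 := Real.log_pos (by norm_num)
  filter_upwards [(Real.tendsto_exp_atTop.comp ht).eventually
      (eventually_maxModulus_le_of_logOrder_lt hs), eventually_ge_atTop 1,
    hlim.eventually (eventually_const_mul_rpow_le_rpow (2 * (L + Real.log 2)) hp1),
    hlim.eventually (eventually_const_mul_rpow_le_rpow (4 / d * (L + Real.log 2)) hp1),
    hlim.eventually (eventually_const_mul_rpow_le_rpow (4 / d) hyp)] with n h1 hn h2 h3 h4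
  have hn1 : (1 : ℝ) ≤ n := by exact_mod_cast hn
  have hn0 : (0 : ℝ) < n := by linarith
  rw [Real.rpow_one] at h2 h3
  simp only [Function.comp_apply, Real.log_exp] at h1
  set t : ℝ := 2⁻¹ * (n : ℝ) ^ p with htdef
  have ht0 : 0 < t := by positivity
  have hqn : q ^ n = Real.exp (-(n * L)) := by
    rw [hL, mul_neg, neg_neg, ← Real.log_pow, Real.exp_log (pow_pos hq0 n)]
  have h2exp : (2 : ℝ) = Real.exp (Real.log 2) := (Real.exp_log (by norm_num)).symm
  have hR : 2 ≤ Real.exp t * q ^ n := by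
    rw [hqn, ← Real.exp_add]
    nth_rewrite 1 [h2exp]
    refine Real.exp_le_exp.2 ?_
    nlinarith
  have hts : t ^ s = t * ((1 - d) * n) := by
    have e1 : t ^ (s - 1) = (1 - d) * n := by
      rw [htdef, Real.mul_rpow (by norm_num) (by positivity), ← Real.rpow_mul hn0.le, hp,
        one_div_mul_cancel hs0.ne', Real.rpow_one, hd]
      ring
    rw [← e1, ← Real.rpow_one_add' ht0.le (by linarith)]
    ring_nf
  have hpow : (2 / (Real.exp t * q ^ n)) ^ n = Real.exp (n * (Real.log 2 - t + n * L)) := by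
    rw [hqn, ← Real.exp_add, Real.exp_nat_mul]
    nth_rewrite 1 [h2exp]
    rw [← Real.exp_sub]
    ring_nf
  have hny : (n : ℝ) ^ y = n * (n : ℝ) ^ (y - 1) := by
    rw [Real.rpow_sub_one hn0.ne', mul_div_cancel₀ _ hn0.ne']
  calc ‖a n‖ ≤ maxModulus f (Real.exp t) * (2 / (Real.exp t * q ^ n)) ^ n :=
        norm_coeff_le hq0 hq1 hf hfa hR
    _ ≤ Real.exp (t ^ s) * Real.exp (n * (Real.log 2 - t + n * L)) := by
        rw [hpow]
        gcongr
    _ = Real.exp (n * (-(d * t) + n * L + Real.log 2)) := by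
        rw [← Real.exp_add, hts]
        ring_nf
    _ ≤ Real.exp (-(n : ℝ) ^ y) := by
        refine Real.exp_le_exp.2 ?_
        rw [hny, ← mul_neg (n : ℝ)]
        refine mul_le_mul_of_nonneg_left ?_ hn0.le
        have e3 : 2 * (L + Real.log 2) * n ≤ d * t := by
          rw [htdef]
          have := mul_le_mul_of_nonneg_left h3 hd0.le
          field_simp at this ⊢
          linarith
        have e4 : 2 * (n : ℝ) ^ (y - 1) ≤ d * t := by
          rw [htdef]
          have := mul_le_mul_of_nonneg_left h4 hd0.le
          field_simp at this ⊢
          linarith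
        nlinarith

end Newton

/-! ### From the decay of the coefficients to the growth of the function -/

section Growth

variable {q : ℝ} {f : ℂ → ℂ} {a : ℕ → ℂ}

theorem norm_awBasis_le (hq0 : 0 < q) (hq1 : q < 1) {r : ℝ} (hr : 1 ≤ r) {z : ℂ} (hz : ‖z‖ = r)
    (k : ℕ) : ‖awBasis q 1 k z‖ ≤ (4 * r) ^ k := by
  rw [awBasis, norm_prod]
  refine (Finset.prod_le_prod (fun _ _ => norm_nonneg _) (g := fun _ => 4 * r) ?_).trans (by simp)
  intro j _
  have h1 (m : ℕ) : ‖(q : ℂ) ^ m‖ ≤ 1 := by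
    rw [norm_pow, Complex.norm_real, Real.norm_of_nonneg hq0.le]
    exact pow_le_one₀ hq0.le hq1.le
  have h2 : ‖2 * 1 * z * (q : ℂ) ^ j‖ ≤ 2 * r := by
    rw [norm_mul, mul_one, norm_mul, hz, Complex.norm_ofNat]
    exact mul_le_of_le_one_right (by linarith) (h1 j)
  have h3 := norm_add_le (1 - 2 * 1 * z * (q : ℂ) ^ j) (1 ^ 2 * (q : ℂ) ^ (2 * j))
  have h4 := norm_sub_le 1 (2 * 1 * z * (q : ℂ) ^ j)
  rw [norm_one] at h4
  rw [one_pow, one_mul] at h3 ⊢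
  linarith [h1 (2 * j)]

theorem nat_mul_sub_rpow_le {y T : ℝ} (hy : 1 < y) (hT : 0 ≤ T) (k : ℕ) :
    k * T - (k : ℝ) ^ y ≤ T ^ (y / (y - 1)) := by
  have hy0 : 0 < y - 1 := by linarith
  have hk : (0 : ℝ) ≤ k := k.cast_nonneg
  have hky : (k : ℝ) ^ y = k * (k : ℝ) ^ (y - 1) := by
    rw [← Real.rpow_one_add' hk (by linarith)]
    ring_nf
  rcases le_or_gt T ((k : ℝ) ^ (y - 1)) with h | h
  · have := mul_le_mul_of_nonneg_left h hk
    have := Real.rpow_nonneg hT (y / (y - 1))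
    linarith
  · have h1 : (k : ℝ) ≤ T ^ (1 / (y - 1)) := by
      have := Real.rpow_le_rpow (by positivity) h.le (one_div_nonneg.2 hy0.le)
      rwa [← Real.rpow_mul hk, mul_one_div_cancel hy0.ne', Real.rpow_one] at this
    have h2 : T ^ (y / (y - 1)) = T ^ (1 / (y - 1)) * T := by
      rw [← Real.rpow_add_one' hT (by positivity)]
      congr 1
      field_simp
      ring
    have := mul_le_mul_of_nonneg_right h1 hT
    have : (0 : ℝ) ≤ (k : ℝ) ^ y := by positivity
    linarith

theorem logOrder_le_of_norm_coeff_le (hq0 : 0 < q) (hq1 : q < 1)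
    (hfa : ∀ x : ℂ, Tendsto
      (fun n : ℕ => ∑ k ∈ Finset.range n, a k * awBasis q 1 k x) atTop (𝓝 (f x)))
    {y s : ℝ} (hy : 1 < y) (ha : ∀ᶠ n : ℕ in atTop, ‖a n‖ ≤ Real.exp (-(n : ℝ) ^ y))
    (hs : y / (y - 1) < s) : logOrder f ≤ s := by
  have hy0 : 0 < y - 1 := by linarith
  set p : ℝ := y / (y - 1) with hp
  have hp0 : 0 < p := by positivity
  obtain ⟨C, hC0, hC⟩ : ∃ C : ℝ, 0 < C ∧ ∀ n : ℕ, ‖a n‖ ≤ C * Real.exp (-(n : ℝ) ^ y) := by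
    obtain ⟨N, hN⟩ := eventually_atTop.1 ha
    refine ⟨1 + ∑ n ∈ Finset.range N, ‖a n‖ * Real.exp ((n : ℝ) ^ y), by positivity, fun n => ?_⟩
    rcases le_or_gt N n with h | h
    · refine (hN n h).trans (le_mul_of_one_le_left (Real.exp_pos _).le ?_)
      exact le_add_of_nonneg_right (by positivity)
    · rw [Real.exp_neg, ← div_eq_mul_inv, le_div_iff₀ (Real.exp_pos _)]
      have := Finset.single_le_sum (f := fun n : ℕ => ‖a n‖ * Real.exp ((n : ℝ) ^ y))
        (fun i _ => by positivity) (Finset.mem_range.2 h)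
      linarith
  have hsum : Summable fun k : ℕ => Real.exp (-(k : ℝ)) := Real.summable_exp_neg_nat
  set S : ℝ := ∑' k : ℕ, Real.exp (-(k : ℝ)) with hS
  have hS0 : 0 < S := hsum.tsum_pos (fun _ => (Real.exp_pos _).le) 0 (Real.exp_pos _)
  have hbound (r : ℝ) (hr : 1 ≤ r) :
      maxModulus f r ≤ C * S * Real.exp ((Real.log (4 * r) + 1) ^ p) := by
    refine maxModulus_le (by positivity) fun z hz => ?_
    refine le_of_tendsto (hfa z).norm (Eventually.of_forall fun n => ?_)
    set T := Real.log (4 * r) with hT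
    have hT0 : 0 ≤ T := Real.log_nonneg (by linarith)
    have hterm (k : ℕ) : ‖a k * awBasis q 1 k z‖ ≤
        C * Real.exp ((T + 1) ^ p) * Real.exp (-(k : ℝ)) := by
      rw [norm_mul]
      refine (mul_le_mul (hC k) (norm_awBasis_le hq0 hq1 hr hz k) (norm_nonneg _)
        (by positivity)).trans ?_
      have e : (4 * r) ^ k = Real.exp (k * T) := by
        rw [hT, ← Real.log_pow, Real.exp_log (by positivity)]
      rw [e, mul_assoc, mul_assoc, ← Real.exp_add, ← Real.exp_add]
      refine mul_le_mul_of_nonneg_left (Real.exp_le_exp.2 ?_) hC0.le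
      have := nat_mul_sub_rpow_le hy (by linarith : 0 ≤ T + 1) k
      linarith
    calc _ ≤ ∑ k ∈ Finset.range n, ‖a k * awBasis q 1 k z‖ := norm_sum_le _ _
      _ ≤ ∑ k ∈ Finset.range n, C * Real.exp ((T + 1) ^ p) * Real.exp (-(k : ℝ)) :=
          Finset.sum_le_sum fun k _ => hterm k
      _ = C * Real.exp ((T + 1) ^ p) * ∑ k ∈ Finset.range n, Real.exp (-(k : ℝ)) := by
          rw [Finset.mul_sum]
      _ ≤ C * Real.exp ((T + 1) ^ p) * S := by
          gcongr
          exact hsum.sum_le_tsum _ fun _ _ => (Real.exp_pos _).le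
      _ = _ := by ring
  refine logOrder_le_of_eventually_maxModulus_le (hp0.trans hs).le ?_
  have hl := Real.tendsto_log_atTop
  filter_upwards [eventually_ge_atTop 1, hl.eventually_ge_atTop (Real.log 4 + 1),
    ((tendsto_rpow_atTop hp0).comp hl).eventually_ge_atTop (Real.log (C * S)),
    hl.eventually (eventually_const_mul_rpow_le_rpow (2 ^ p + 1) hs)] with r h1 h2 h3 h4
  have hl4 : 0 < Real.log 4 := Real.log_pos (by norm_num)
  refine (hbound r h1).trans ?_
  rw [← Real.exp_log (show 0 < C * S by positivity), ← Real.exp_add]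
  refine Real.exp_le_exp.2 ?_
  have h5 : (Real.log (4 * r) + 1) ^ p ≤ 2 ^ p * Real.log r ^ p := by
    rw [Real.log_mul (by norm_num) (by linarith), ← Real.mul_rpow (by norm_num) (by linarith)]
    exact Real.rpow_le_rpow (by linarith [Real.log_nonneg h1]) (by linarith) hp0.le
  simp only [Function.comp_apply] at h3
  linarith

end Growth

theorem theorem4p4 (q : ℝ) (hq0 : 0 < q) (hq1 : q < 1) (f : ℂ → ℂ) (a : ℕ → ℂ)
    (hf : Differentiable ℂ f)
    (hfa : ∀ x : ℂ, Tendsto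
      (fun n : ℕ => ∑ k ∈ Finset.range n, a k * awBasis q 1 k x) atTop (𝓝 (f x)))
    (hnc : ¬ ∃ c : ℂ, ∀ x : ℂ, f x = c)
    (hσ : logOrder f < 2) :
    extRecip (logOrder f - 1) =
      liminf (fun n : ℕ => logLogInv (a n) / ((Real.log (n : ℝ) : ℝ) : EReal)) atTop - 1 := by
  have h1 := one_le_logOrder hq0 hq1 hf hfa hnc
  obtain ⟨σ, hσeq⟩ : ∃ σ : ℝ, logOrder f = σ := by
    refine ⟨(logOrder f).toReal, (EReal.coe_toReal hσ.ne_top ?_).symm⟩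
    rintro h
    rw [h] at h1
    exact absurd h1 (not_le.2 (EReal.bot_lt_coe 1))
  set L := liminf (fun n : ℕ => logLogInv (a n) / ((Real.log (n : ℝ) : ℝ) : EReal)) atTop with hL
  have hσ1 : 1 ≤ σ := by rw [hσeq] at h1; exact_mod_cast h1
  have hσ2 : σ < 2 := by 
    rw [hσeq] at hσ
    exact EReal.coe_lt_coe_iff.1 hσ
  have lower (y : ℝ) (hy : (y - 1) * (σ - 1) < 1) : (y : EReal) ≤ L := by
    have hev : ∀ᶠ s : ℝ in 𝓝[>] σ, (y - 1) * (s - 1) < 1 ∧ s < 2 ∧ σ < s := by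
      refine (Eventually.filter_mono nhdsWithin_le_nhds ?_).and
        ((Eventually.filter_mono nhdsWithin_le_nhds (eventually_lt_nhds hσ2)).and
          self_mem_nhdsWithin)
      have hc : Continuous fun s : ℝ => (y - 1) * (s - 1) := by fun_prop
      exact hc.continuousAt.eventually_lt_const hy
    obtain ⟨s, hs1, hs2, hs⟩ := hev.exists
    refine le_liminf_of_le (by isBoundedDefault) ?_
    filter_upwards [eventually_ge_atTop 2, eventually_norm_coeff_le hq0 hq1 hf hfa
      (hσ1.trans_lt hs) hs2 (by rw [hσeq]; exact_mod_cast hs) hs1] with n hn h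
    exact (coe_le_logLogInv_div_log_iff hn).2 h
  have upper (y : ℝ) (hy : 1 < y) (hyL : (y : EReal) < L) : (y - 1) * (σ - 1) ≤ 1 := by
    have hev : ∀ᶠ n : ℕ in atTop, ‖a n‖ ≤ Real.exp (-(n : ℝ) ^ y) := by
      filter_upwards [eventually_ge_atTop 2, eventually_lt_of_lt_liminf hyL] with n hn h
      exact (coe_le_logLogInv_div_log_iff hn).1 h.le
    have hle : σ ≤ y / (y - 1) := by
      refine le_of_forall_gt_imp_ge_of_dense fun s hs => ?_
      have := logOrder_le_of_norm_coeff_le hq0 hq1 hfa hy hev hs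
      rw [hσeq] at this
      exact_mod_cast this
    rw [le_div_iff₀ (by linarith)] at hle
    linarith
  have hsub : logOrder f - 1 = ((σ - 1 : ℝ) : EReal) := by rw [hσeq]; norm_cast
  rw [hsub]
  rcases hσ1.eq_or_lt with hσ1 | hσ1
  · have hLtop : L = ⊤ := by
      refine (EReal.eq_top_iff_forall_lt _).2 fun y => ?_
      refine lt_of_lt_of_le ?_ (lower (y + 1) (by rw [← hσ1]; norm_num))
      exact_mod_cast lt_add_one y
    rw [hLtop, ← hσ1]
    simp only [extRecip, sub_self, EReal.coe_zero, if_true]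
    rfl
  · have hσ0 : 0 < σ - 1 := by linarith
    have hLeq : L = ((1 + 1 / (σ - 1) : ℝ) : EReal) := by
      apply le_antisymm
      · by_contra! hlt
        obtain ⟨y, hy1, hy2⟩ := EReal.lt_iff_exists_real_btwn.1 hlt
        have hy1 : 1 + 1 / (σ - 1) < y := by exact_mod_cast hy1
        have : 0 < 1 / (σ - 1) := by positivity
        have h3 := upper y (by linarith) hy2
        rw [← le_div_iff₀ hσ0] at h3
        linarith
      · refine EReal.ge_of_forall_gt_iff_ge.1 fun y hy => lower y ?_
        have hy : y < 1 + 1 / (σ - 1) := by exact_mod_cast hy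
        rw [← lt_div_iff₀ hσ0]
        linarith
    rw [hLeq, extRecip, if_neg (by exact_mod_cast hσ0.ne'), ← EReal.coe_inv]
    norm_cast
    ring_nf
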